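/- Let $(R,\mathfrak m)$ be a commutative noetherian local ring of Krull dimension $d$, let $\widehat R$ be its $\mathfrak m$-adic completion, and let $\mathcal M$ be a finitely generated $\widehat R$-module of finite projective dimension over $\widehat R$. Suppose that one of the following holds: (i) $d=1$; (ii) $d=2$ and $\mathcal M$ is torsion-less, i.e. the canonical map $\mathcal M\to\mathcal M^{**}$ is injective, where $(-)^*=\operatorname{Hom}_{\widehat R}(-,\widehat R)$; (iii) $d=3$ and $\mathcal M$ is reflexive, i.e. the canonical map $\mathcal M\to\mathcal M^{**}$ is bijective. Then $\mathcal M$ is strongly algebraic: for every direct summand $\mathcal N$ of $\mathcal M$ there is a finitely generated $R$-module $N$ whose $\mathfrak m$-adic completion $\widehat N$ is isomorphic to $\mathcal N$ as an $\widehat R$-module. -/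

import Mathlib

universe u v

/-- The completion `R̂` of a local ring `R` with respect to its maximal ideal. -/
abbrev LocalCompletion (R : Type u) [CommRing R] [IsLocalRing R] : Type u :=
  AdicCompletion (IsLocalRing.maximalIdeal R) R

/-- An `R̂`-module `M` is algebraic if it is isomorphic, as an `R̂`-module, to the completion
`N̂` (for the maximal ideal of `R`) of a finitely generated `R`-module `N`. -/
def IsAlgebraicModule (R : Type u) [CommRing R] [IsLocalRing R] (M : Type v) [AddCommGroup M]
    [Module (LocalCompletion R) M] : Prop :=
  ∃ (N : Type u) (_ : AddCommGroup N) (_ : Module R N), Module.Finite R N ∧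
    Nonempty (M ≃ₗ[LocalCompletion R] AdicCompletion (IsLocalRing.maximalIdeal R) N)

/-- An `R̂`-module is strongly algebraic if each of its direct summands is algebraic. -/
def IsStronglyAlgebraicModule (R : Type u) [CommRing R] [IsLocalRing R] (M : Type v)
    [AddCommGroup M] [Module (LocalCompletion R) M] : Prop :=
  ∀ P Q : Submodule (LocalCompletion R) M, IsCompl P Q → IsAlgebraicModule R P

/-- A module is torsion-less if the canonical map to its double dual is injective. -/
def IsTorsionlessModule (A : Type u) [CommRing A] (M : Type v) [AddCommGroup M] [Module A M] :
    Prop :=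
  Function.Injective (Module.Dual.eval A M)

/-- A module has finite projective dimension (the zero module is included). -/
def HasFiniteProjectiveDimension (A : Type u) [CommRing A] (M : Type u) [AddCommGroup M]
    [Module A M] : Prop :=
  ∃ n : ℕ, CategoryTheory.HasProjectiveDimensionLE (ModuleCat.of A M) n

/-! Write S for the completion, with maximal ideal m, and let e be 0, 1, 2 in cases (i), (ii),
(iii), so dim S ≤ e + 1. A summand P of M inherits finite projective dimension, and torsion-lessness
or reflexivity makes it an e-th syzygy. The key is `mem_maximalIdeal_of_mulVec_mem`: over a
noetherian local ring of dimension at most e, an injective matrix whose cokernel is an e-th syzygy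
stays injective modulo the maximal ideal, hence splits.

This first yields P = coker A with A injective (`free_of_isSyzygyOfOrder`). Applied again at the
nonmaximal primes, where the dimension is at most e, it splits A on the punctured spectrum, so for
some k every a in m^k satisfies a • 1 = B * A for some B. Changing A modulo m^(k+1) then only
multiplies it by an invertible matrix (`exists_isUnit_mul_eq_of_sub_mem`). Since R is dense in S,
the entries can be moved into R, and P is the completion of the resulting cokernel. -/

open IsLocalRing Matrix CategoryTheory

/-! ### Noetherianity, dimension and density for the completion -/

section Completion

variable (R : Type u) [CommRing R] [IsLocalRing R]

variable {R} in
lemma idealOfVars_pow_le_comap_aeval {n : ℕ} {x : Fin n → R} (hx : ∀ i, x i ∈ maximalIdeal R)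
    (k : ℕ) : MvPolynomial.idealOfVars (Fin n) R ^ k ≤
      (maximalIdeal R ^ k).comap (MvPolynomial.aeval (R := R) x).toRingHom := by
  refine (Ideal.pow_right_mono ?_ k).trans (Ideal.le_comap_pow _ k)
  rw [Ideal.span_le]
  rintro _ ⟨i, rfl⟩
  simpa using hx i

variable {R} in
/-- Evaluation of formal power series modulo a power of the maximal ideal. -/
noncomputable def powerSeriesEvalModPow {n : ℕ} (x : Fin n → R) (hx : ∀ i, x i ∈ maximalIdeal R)
    (k : ℕ) : AdicCompletion (MvPolynomial.idealOfVars (Fin n) R) (MvPolynomial (Fin n) R) →+*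
      R ⧸ maximalIdeal R ^ k :=
  (Ideal.quotientMap (maximalIdeal R ^ k) (MvPolynomial.aeval (R := R) x).toRingHom
    (idealOfVars_pow_le_comap_aeval hx k)).comp
      (AdicCompletion.evalₐ (MvPolynomial.idealOfVars (Fin n) R) k).toRingHom

lemma factorPow_comp_powerSeriesEvalModPow {n : ℕ} (x : Fin n → R)
    (hx : ∀ i, x i ∈ maximalIdeal R) {k l : ℕ} (hkl : k ≤ l) :
    (Ideal.Quotient.factorPow (maximalIdeal R) hkl).comp (powerSeriesEvalModPow x hx l) =
      powerSeriesEvalModPow x hx k := by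
  ext p
  obtain ⟨p, rfl⟩ := AdicCompletion.mk_surjective _ _ p
  simp [powerSeriesEvalModPow, AdicCompletion.evalₐ_mk, ← AdicCompletion.Ideal.mk_eq_mk _ hkl p]

/-- Evaluation of formal power series at finitely many elements of the maximal ideal. -/
noncomputable def powerSeriesEvalAtMaximalIdeal {n : ℕ} (x : Fin n → R)
    (hx : ∀ i, x i ∈ maximalIdeal R) :
    AdicCompletion (MvPolynomial.idealOfVars (Fin n) R) (MvPolynomial (Fin n) R) →+*
      LocalCompletion R :=
  AdicCompletion.liftRingHom (maximalIdeal R) (powerSeriesEvalModPow x hx)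
    (factorPow_comp_powerSeriesEvalModPow R x hx)

lemma powerSeriesEvalAtMaximalIdeal_algebraMap {n : ℕ} (x : Fin n → R)
    (hx : ∀ i, x i ∈ maximalIdeal R) (p : MvPolynomial (Fin n) R) :
    powerSeriesEvalAtMaximalIdeal R x hx (algebraMap _ _ p) =
      algebraMap R (LocalCompletion R) (MvPolynomial.aeval x p) := by
  refine AdicCompletion.ext_evalₐ fun k => ?_
  refine (AdicCompletion.evalₐ_liftRingHom _ _ (factorPow_comp_powerSeriesEvalModPow R x hx)
    _ _).trans ?_
  simp [powerSeriesEvalModPow, AdicCompletion.algebraMap_apply]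

variable [IsNoetherianRing R]

/-- Generators of the maximal ideal present the completion as a quotient of a power series ring over
R. Surjectivity is checked modulo the ideal of the variables, where it reduces to the isomorphism of
residue fields. -/
instance LocalCompletion.isNoetherianRing : IsNoetherianRing (LocalCompletion R) := by
  obtain ⟨n, x, hx⟩ := Submodule.fg_iff_exists_fin_generating_family.mp
    (maximalIdeal R).fg_of_isNoetherianRing
  have hxm : ∀ i, x i ∈ maximalIdeal R := fun i => hx ▸ Submodule.subset_span ⟨i, rfl⟩
  let P := MvPolynomial (Fin n) R
  let J := MvPolynomial.idealOfVars (Fin n) R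
  have : IsNoetherianRing (AdicCompletion J P) :=
    isNoetherianRing_of_ringEquiv (MvPowerSeries (Fin n) R)
      (MvPowerSeries.toAdicCompletionAlgEquiv (Fin n) R).toRingEquiv
  let φ := powerSeriesEvalAtMaximalIdeal R x hxm
  have hmap : (J.map (algebraMap P (AdicCompletion J P))).map φ =
      maximalIdeal (LocalCompletion R) := by
    have hcomp : φ.comp (algebraMap P (AdicCompletion J P)) =
        (algebraMap R (LocalCompletion R)).comp (MvPolynomial.aeval (R := R) x).toRingHom :=
      RingHom.ext fun p => powerSeriesEvalAtMaximalIdeal_algebraMap R x hxm p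
    have hJ : J.map (MvPolynomial.aeval (R := R) x).toRingHom = maximalIdeal R := by
      rw [← hx, Ideal.map_span, ← Set.range_comp]
      congr 2
      ext1 i
      simp
    rw [Ideal.map_map, hcomp, ← Ideal.map_map, hJ, AdicCompletion.maximalIdeal_eq_map]
  have := (AdicCompletion.isAdicComplete_self J
    (MvPolynomial.idealOfVars_fg (Fin n) R)).toIsPrecomplete
  have : IsHausdorff ((J.map (algebraMap P (AdicCompletion J P))).map φ) (LocalCompletion R) := by
    rw [hmap]
    infer_instance
  refine isNoetherianRing_of_surjective _ _ φ
    (surjective_of_mk_map_comp_surjective (I := J.map (algebraMap P (AdicCompletion J P))) φ ?_)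
  intro y
  obtain ⟨y, rfl⟩ := Ideal.Quotient.mk_surjective y
  obtain ⟨r, hr⟩ := (AdicCompletion.residueField_map_bijective R).2 (residue _ y)
  obtain ⟨r, rfl⟩ := residue_surjective r
  refine ⟨algebraMap P _ (MvPolynomial.C r), ?_⟩
  rw [RingHom.comp_apply, powerSeriesEvalAtMaximalIdeal_algebraMap,
    Ideal.Quotient.mk_eq_mk_iff_sub_mem,
    hmap, ← Ideal.Quotient.mk_eq_mk_iff_sub_mem]
  rw [MvPolynomial.aeval_C]
  exact hr

/-- The closed fibre is a field, so it adds nothing to the height. -/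
lemma ringKrullDim_localCompletion_le :
    ringKrullDim (LocalCompletion R) ≤ ringKrullDim R := by
  rw [← maximalIdeal_height_eq_ringKrullDim, ← maximalIdeal_height_eq_ringKrullDim]
  have : (maximalIdeal (LocalCompletion R)).LiesOver (maximalIdeal R) :=
    ⟨(maximalIdeal_comap (algebraMap R (LocalCompletion R))).symm⟩
  have h := Ideal.height_le_height_add_of_liesOver (maximalIdeal R)
    (maximalIdeal (LocalCompletion R))
  rw [← AdicCompletion.maximalIdeal_eq_map, Ideal.map_quotient_self] at h
  have := (Ideal.Quotient.nontrivial_iff (I := maximalIdeal (LocalCompletion R))).2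
    Ideal.IsPrime.ne_top'
  let := Ideal.Quotient.field (maximalIdeal (LocalCompletion R))
  rw [Ideal.height_bot, add_zero] at h
  exact_mod_cast h

lemma exists_sub_algebraMap_mem_maximalIdeal_pow (y : LocalCompletion R) (k : ℕ) :
    ∃ r : R, y - algebraMap R (LocalCompletion R) r ∈ maximalIdeal (LocalCompletion R) ^ k := by
  obtain ⟨r, hr⟩ := Submodule.Quotient.mk_surjective _ (AdicCompletion.eval (maximalIdeal R) R k y)
  refine ⟨r, ?_⟩
  rw [AdicCompletion.maximalIdeal_eq_map, ← Ideal.map_pow, ← Submodule.restrictScalars_mem R,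
    ← Ideal.smul_top_eq_map,
    AdicCompletion.pow_smul_top_eq_ker_eval (maximalIdeal R).fg_of_isNoetherianRing,
    LinearMap.mem_ker, map_sub, ← hr, sub_eq_zero]
  rfl

end Completion

/-! ### Syzygies modulo a regular element -/

section Syzygy

/-- A submodule `N` of `S ^ m` is a syzygy of order `d` relative to its embedding if the quotient
`S ^ m ⧸ N` starts an exact sequence `0 → S ^ m ⧸ N → S ^ l₁ → ⋯ → S ^ l_d`. -/
def IsSyzygyOfOrder {S : Type u} [CommRing S] : ℕ → ∀ {m : ℕ}, Submodule S (Fin m → S) → Prop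
  | 0, _, _ => True
  | d + 1, m, N => ∃ (l : ℕ) (B : Matrix (Fin l) (Fin m) S),
      N = LinearMap.ker B.mulVecLin ∧ IsSyzygyOfOrder d (LinearMap.range B.mulVecLin)

variable {S : Type u} [CommRing S]

lemma IsSyzygyOfOrder.of_succ {d m : ℕ} {N : Submodule S (Fin m → S)}
    (h : IsSyzygyOfOrder (d + 1) N) : IsSyzygyOfOrder d N := by
  induction d generalizing m with
  | zero => trivial
  | succ d ih =>
    obtain ⟨l, B, hB, h⟩ := h
    exact ⟨l, B, hB, ih h⟩

lemma map_comp_mulVec {T : Type v} [CommRing T] (f : S →+* T) {m n : ℕ}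
    (A : Matrix (Fin m) (Fin n) S) (v : Fin n → S) :
    A.map f *ᵥ (f ∘ v) = f ∘ (A *ᵥ v) :=
  funext fun i => (f.map_mulVec A v i).symm

lemma eq_mk_comp {m : ℕ} {I : Ideal S} (v : Fin m → S ⧸ I) :
    ∃ w : Fin m → S, v = Ideal.Quotient.mk I ∘ w := by
  choose w hw using fun i => Ideal.Quotient.mk_surjective (v i)
  exact ⟨w, funext fun i => (hw i).symm⟩

lemma mk_comp_eq_zero_iff {m : ℕ} {x : S} (v : Fin m → S) :
    Ideal.Quotient.mk (Ideal.span {x}) ∘ v = 0 ↔ ∃ w : Fin m → S, v = x • w := by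
  constructor
  · intro h
    have h' : ∀ i, ∃ w, v i = x * w := fun i =>
      Ideal.mem_span_singleton'.mp (Ideal.Quotient.eq_zero_iff_mem.mp (congrFun h i)) |>.imp
        fun w hw => by rw [← hw, mul_comm]
    choose w hw using h'
    exact ⟨w, funext hw⟩
  · rintro ⟨w, rfl⟩
    ext i
    simp

lemma smul_eq_zero_of_mem_nonZeroDivisors {m : ℕ} {x : S} (hx : x ∈ nonZeroDivisors S)
    {v : Fin m → S} (h : x • v = 0) : v = 0 :=
  funext fun i => (mul_right_mem_nonZeroDivisors_eq_zero_iff hx).mp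
    (by rw [mul_comm]; exact congrFun h i)

/-- Lifting a relation B v = x w, regularity of x gives C w = 0, so w = B u and v - x u lies in the
range of A. Exactness one place further on is consumed, which is why reduction costs one syzygy
order. -/
lemma range_map_mk_eq_ker {x : S} (hx : x ∈ nonZeroDivisors S) {m l k : ℕ} {n : ℕ}
    {A : Matrix (Fin m) (Fin n) S} {B : Matrix (Fin l) (Fin m) S} {C : Matrix (Fin k) (Fin l) S}
    (hAB : LinearMap.range A.mulVecLin = LinearMap.ker B.mulVecLin)
    (hBC : LinearMap.range B.mulVecLin = LinearMap.ker C.mulVecLin) :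
    LinearMap.range (A.map (Ideal.Quotient.mk (Ideal.span {x}))).mulVecLin =
      LinearMap.ker (B.map (Ideal.Quotient.mk (Ideal.span {x}))).mulVecLin := by
  have hBA (v) : B *ᵥ (A *ᵥ v) = 0 := by
    have : A.mulVecLin v ∈ LinearMap.ker B.mulVecLin := hAB ▸ LinearMap.mem_range_self _ v
    simpa using this
  have hCB (v) : C *ᵥ (B *ᵥ v) = 0 := by
    have : B.mulVecLin v ∈ LinearMap.ker C.mulVecLin := hBC ▸ LinearMap.mem_range_self _ v
    simpa using this
  apply le_antisymm
  · rintro _ ⟨v, rfl⟩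
    obtain ⟨v, rfl⟩ := eq_mk_comp v
    rw [LinearMap.mem_ker, mulVecLin_apply, mulVecLin_apply, map_comp_mulVec, map_comp_mulVec, hBA]
    ext; simp
  · intro v hv
    obtain ⟨v, rfl⟩ := eq_mk_comp v
    rw [LinearMap.mem_ker, mulVecLin_apply, map_comp_mulVec, mk_comp_eq_zero_iff] at hv
    obtain ⟨w, hw⟩ := hv
    have hw0 : C *ᵥ w = 0 := by
      apply smul_eq_zero_of_mem_nonZeroDivisors hx
      rw [← mulVec_smul, ← hw, hCB]
    have : w ∈ LinearMap.range B.mulVecLin := hBC ▸ hw0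
    obtain ⟨u, rfl⟩ := this
    have : v - x • u ∈ LinearMap.range A.mulVecLin := by
      rw [hAB, LinearMap.mem_ker, map_sub, map_smul, mulVecLin_apply, hw, sub_self]
    obtain ⟨t, ht⟩ := this
    refine ⟨Ideal.Quotient.mk _ ∘ t, ?_⟩
    rw [mulVecLin_apply, map_comp_mulVec, ← mulVecLin_apply, ht]
    ext i
    simp

lemma IsSyzygyOfOrder.map_mk {x : S} (hx : x ∈ nonZeroDivisors S) {d m n : ℕ}
    {A : Matrix (Fin m) (Fin n) S} (h : IsSyzygyOfOrder (d + 1) (LinearMap.range A.mulVecLin)) :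
    IsSyzygyOfOrder d
      (LinearMap.range (A.map (Ideal.Quotient.mk (Ideal.span {x}))).mulVecLin) := by
  induction d generalizing m n with
  | zero => trivial
  | succ d ih =>
    obtain ⟨l, B, hAB, hB⟩ := h
    have hB' := hB
    obtain ⟨k, C, hBC, -⟩ := hB'
    exact ⟨l, B.map _, range_map_mk_eq_ker hx hAB hBC, ih hB⟩

lemma map_mk_mulVec_injective {x : S} (hx : x ∈ nonZeroDivisors S) {m l n : ℕ}
    {A : Matrix (Fin m) (Fin n) S} {B : Matrix (Fin l) (Fin m) S}
    (hA : ∀ v, A *ᵥ v = 0 → v = 0)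
    (hAB : LinearMap.range A.mulVecLin = LinearMap.ker B.mulVecLin) (v)
    (hv : A.map (Ideal.Quotient.mk (Ideal.span {x})) *ᵥ v = 0) : v = 0 := by
  have hBA (v) : B *ᵥ (A *ᵥ v) = 0 := by
    have : A.mulVecLin v ∈ LinearMap.ker B.mulVecLin := hAB ▸ LinearMap.mem_range_self _ v
    simpa using this
  obtain ⟨v, rfl⟩ := eq_mk_comp v
  rw [map_comp_mulVec, mk_comp_eq_zero_iff] at hv
  obtain ⟨w, hw⟩ := hv
  have hw0 : B *ᵥ w = 0 := by
    apply smul_eq_zero_of_mem_nonZeroDivisors hx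
    rw [← mulVec_smul, ← hw, hBA]
  have : w ∈ LinearMap.range A.mulVecLin := hAB ▸ hw0
  obtain ⟨u, rfl⟩ := this
  refine (mk_comp_eq_zero_iff v).mpr ⟨u, sub_eq_zero.mp (hA _ ?_)⟩
  rw [mulVec_sub, hw, mulVec_smul, mulVecLin_apply, sub_self]

end Syzygy

/-! ### Syzygies under localization -/

section Localization

variable {S : Type u} [CommRing S] (W : Submonoid S) (T : Type u) [CommRing T] [Algebra S T]
  [IsLocalization W T]

include W in
lemma exists_smul_eq_algebraMap_comp {m : ℕ} (v : Fin m → T) :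
    ∃ (s : W) (w : Fin m → S), algebraMap S T s • v = algebraMap S T ∘ w := by
  obtain ⟨s, hs⟩ := IsLocalization.exist_integer_multiples_of_finite W v
  choose w hw using hs
  exact ⟨s, w, funext fun i => by simp [hw, Algebra.smul_def]⟩

lemma exists_smul_eq_zero_of_algebraMap_comp_eq_zero {m : ℕ} {v : Fin m → S}
    (h : algebraMap S T ∘ v = 0) : ∃ s : W, (s : S) • v = 0 := by
  have h' : ∀ i, ∃ s : W, (s : S) * v i = 0 := fun i =>
    (IsLocalization.map_eq_zero_iff W T (v i)).mp (congrFun h i)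
  choose s hs using h'
  refine ⟨∏ i, s i, funext fun i => ?_⟩
  obtain ⟨c, hc⟩ := Finset.dvd_prod_of_mem s (Finset.mem_univ i)
  simp only [Pi.smul_apply, smul_eq_mul, Pi.zero_apply, hc, Submonoid.coe_mul]
  rw [mul_right_comm, hs, zero_mul]

include W in
lemma eq_zero_of_algebraMap_smul_eq_zero {m : ℕ} (s : W) {v : Fin m → T}
    (h : algebraMap S T s • v = 0) : v = 0 :=
  ((IsLocalization.map_units T s).smul_eq_zero).mp h

include W in
lemma mulVec_map_algebraMap_injective {m n : ℕ} {A : Matrix (Fin m) (Fin n) S}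
    (hA : ∀ v, A *ᵥ v = 0 → v = 0) (v) (hv : A.map (algebraMap S T) *ᵥ v = 0) : v = 0 := by
  obtain ⟨s, w, hw⟩ := exists_smul_eq_algebraMap_comp W T v
  have : algebraMap S T ∘ (A *ᵥ w) = 0 := by
    rw [← map_comp_mulVec, ← hw, mulVec_smul, hv, smul_zero]
  obtain ⟨t, ht⟩ := exists_smul_eq_zero_of_algebraMap_comp_eq_zero W T this
  rw [← mulVec_smul] at ht
  have h0 : algebraMap S T t • algebraMap S T ∘ w = 0 := by
    ext i
    have := congrFun (hA _ ht) i
    simpa using congrArg (algebraMap S T) this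
  rw [← hw] at h0
  exact eq_zero_of_algebraMap_smul_eq_zero W T s (eq_zero_of_algebraMap_smul_eq_zero W T t h0)

include W in
lemma range_map_algebraMap_eq_ker {m n l : ℕ} {A : Matrix (Fin m) (Fin n) S}
    {B : Matrix (Fin l) (Fin m) S}
    (hAB : LinearMap.range A.mulVecLin = LinearMap.ker B.mulVecLin) :
    LinearMap.range (A.map (algebraMap S T)).mulVecLin =
      LinearMap.ker (B.map (algebraMap S T)).mulVecLin := by
  have hBA (v) : B *ᵥ (A *ᵥ v) = 0 := by
    have : A.mulVecLin v ∈ LinearMap.ker B.mulVecLin := hAB ▸ LinearMap.mem_range_self _ v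
    simpa using this
  apply le_antisymm
  · rintro _ ⟨v, rfl⟩
    obtain ⟨s, w, hw⟩ := exists_smul_eq_algebraMap_comp W T v
    refine eq_zero_of_algebraMap_smul_eq_zero W T s ?_
    rw [← map_smul, ← map_smul, hw, mulVecLin_apply, mulVecLin_apply, map_comp_mulVec,
      map_comp_mulVec, hBA]
    ext; simp
  · intro v hv
    obtain ⟨s, w, hw⟩ := exists_smul_eq_algebraMap_comp W T v
    have : algebraMap S T ∘ (B *ᵥ w) = 0 := by
      rw [← map_comp_mulVec, ← hw, mulVec_smul, ← mulVecLin_apply, hv, smul_zero]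
    obtain ⟨t, ht⟩ := exists_smul_eq_zero_of_algebraMap_comp_eq_zero W T this
    rw [← mulVec_smul] at ht
    have : (t : S) • w ∈ LinearMap.range A.mulVecLin := hAB ▸ ht
    obtain ⟨u, hu⟩ := this
    have key : algebraMap S T t • algebraMap S T s • v =
        (A.map (algebraMap S T)).mulVecLin (algebraMap S T ∘ u) := by
      rw [mulVecLin_apply, map_comp_mulVec, ← mulVecLin_apply, hu, hw]
      ext; simp
    obtain ⟨a, ha⟩ := (IsLocalization.map_units T t).exists_left_inv
    obtain ⟨b, hb⟩ := (IsLocalization.map_units T s).exists_left_inv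
    refine ⟨b • a • algebraMap S T ∘ u, ?_⟩
    rw [map_smul, map_smul, ← key, smul_smul a, ha, one_smul, smul_smul, hb, one_smul]

include W in
lemma IsSyzygyOfOrder.map_algebraMap {d m n : ℕ} {A : Matrix (Fin m) (Fin n) S}
    (h : IsSyzygyOfOrder d (LinearMap.range A.mulVecLin)) :
    IsSyzygyOfOrder d (LinearMap.range (A.map (algebraMap S T)).mulVecLin) := by
  induction d generalizing m n with
  | zero => trivial
  | succ d ih =>
    obtain ⟨l, B, hAB, hB⟩ := h
    exact ⟨l, B.map _, range_map_algebraMap_eq_ker W T hAB, ih hB⟩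

/-- Denominators are cleared twice: once from B, once to turn an equality in T into one in S. -/
lemma exists_mul_eq_smul_one_of_map_algebraMap {m n : ℕ} {A : Matrix (Fin m) (Fin n) S}
    {B : Matrix (Fin n) (Fin m) T} (h : B * A.map (algebraMap S T) = 1) :
    ∃ (s : W) (B' : Matrix (Fin n) (Fin m) S), B' * A = (s : S) • 1 := by
  obtain ⟨s, hs⟩ := IsLocalization.exist_integer_multiples_of_finite W
    (fun p : Fin n × Fin m => B p.1 p.2)
  choose C hC using hs
  let C' : Matrix (Fin n) (Fin m) S := Matrix.of fun i j => C (i, j)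
  have hC' : C'.map (algebraMap S T) = algebraMap S T s • B := by
    ext i j
    simp [C', hC, Algebra.smul_def]
  have h1 : (C' * A - (s : S) • (1 : Matrix (Fin n) (Fin n) S)).map (algebraMap S T) = 0 := by
    rw [Matrix.map_sub _ (by simp), Matrix.map_mul, hC', Matrix.smul_mul, h, sub_eq_zero]
    ext i j
    by_cases hij : i = j <;> simp [hij]
  have h2 : ∀ p : Fin n × Fin n, ∃ t : W,
      (t : S) * (C' * A - (s : S) • (1 : Matrix (Fin n) (Fin n) S)) p.1 p.2 = 0 := fun p =>
    (IsLocalization.map_eq_zero_iff W T _).mp (congrFun (congrFun h1 p.1) p.2)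
  choose t ht using h2
  refine ⟨(∏ p, t p) * s, ((∏ p, t p : W) : S) • C', ?_⟩
  rw [← sub_eq_zero, Matrix.smul_mul, Submonoid.coe_mul, mul_smul, ← smul_sub]
  ext i j
  obtain ⟨c, hc⟩ := Finset.dvd_prod_of_mem t (Finset.mem_univ (i, j))
  simp only [Matrix.smul_apply, smul_eq_mul, Matrix.zero_apply, hc, Submonoid.coe_mul]
  rw [mul_right_comm, ht, zero_mul]

end Localization

/-! ### Splitting of injective matrices in small dimension -/

section LeftInverse

variable {S : Type u} [CommRing S] [IsLocalRing S]

/-- Prime avoidance: if all of the maximal ideal consists of zero divisors, it is an associated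
prime. -/
lemma exists_mem_nonZeroDivisors_or_exists_smul_eq_zero [IsNoetherianRing S] :
    (∃ x ∈ maximalIdeal S, x ∈ nonZeroDivisors S) ∨
      ∃ s : S, s ≠ 0 ∧ ∀ a ∈ maximalIdeal S, s * a = 0 := by
  by_cases h : ∃ x ∈ maximalIdeal S, x ∈ nonZeroDivisors S
  · exact .inl h
  push Not at h
  right
  have hsub : (maximalIdeal S : Set S) ⊆ ⋃ p ∈ associatedPrimes S S, (p : Set S) := by
    rw [biUnion_associatedPrimes_eq_compl_nonZeroDivisors]
    exact h
  obtain ⟨p, hp, hle⟩ := (Ideal.subset_union_prime_finite (associatedPrimes.finite S S)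
    (f := id) ⊥ ⊥ (fun p hp _ _ => hp.1)).mp hsub
  obtain ⟨hprime, s, hs⟩ := isAssociatedPrime_iff.mp hp
  refine ⟨s, ?_, fun a ha => ?_⟩
  · rintro rfl
    exact hprime.ne_top (hs.trans (by ext; simp [Submodule.mem_colon_singleton]))
  · have : a ∈ p := hle ha
    rw [hs, Submodule.mem_colon_singleton] at this
    simpa [mul_comm] using this

/-- A matrix over a local ring that is injective modulo the maximal ideal has a left inverse. -/
lemma exists_mul_eq_one_of_forall_mem_maximalIdeal {m n : ℕ} (A : Matrix (Fin m) (Fin n) S)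
    (h : ∀ v, (∀ j, (A *ᵥ v) j ∈ maximalIdeal S) → ∀ j, v j ∈ maximalIdeal S) :
    ∃ B : Matrix (Fin n) (Fin m) S, B * A = 1 := by
  have hker : LinearMap.ker (Matrix.toLin' (A.map (residue S))) = ⊥ := by
    rw [LinearMap.ker_eq_bot']
    intro v hv
    choose w hw using fun i => residue_surjective (v i)
    obtain rfl : v = residue S ∘ w := funext fun i => (hw i).symm
    rw [toLin'_apply, map_comp_mulVec] at hv
    have := h w fun j => (residue_eq_zero_iff _).mp (congrFun hv j)
    exact funext fun j => (residue_eq_zero_iff _).mpr (this j)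
  obtain ⟨g, hg⟩ := LinearMap.exists_leftInverse_of_injective _ hker
  choose C hC using fun (i : Fin n) (j : Fin m) => residue_surjective (LinearMap.toMatrix' g i j)
  let C' : Matrix (Fin n) (Fin m) S := Matrix.of C
  have hC' : C'.map (residue S) = LinearMap.toMatrix' g := by
    ext i j
    simp [C', hC]
  have h1 : (C' * A).map (residue S) = 1 := by
    rw [Matrix.map_mul, hC', ← LinearMap.toMatrix'_id, ← hg, LinearMap.toMatrix'_comp,
      LinearMap.toMatrix'_toLin']
  have hdet : IsUnit (C' * A).det := by
    rw [← residue_ne_zero_iff_isUnit, RingHom.map_det, RingHom.mapMatrix_apply, h1, det_one]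
    exact one_ne_zero
  exact ⟨(C' * A)⁻¹ * C', by rw [Matrix.mul_assoc, nonsing_inv_mul _ hdet]⟩

lemma mem_maximalIdeal_of_mulVec_mem_of_smul_eq_zero {s : S} (hs : s ≠ 0)
    (hann : ∀ a ∈ maximalIdeal S, s * a = 0) {m n : ℕ} {A : Matrix (Fin m) (Fin n) S}
    (hA : ∀ v, A *ᵥ v = 0 → v = 0) (v : Fin n → S) (hv : ∀ j, (A *ᵥ v) j ∈ maximalIdeal S)
    (j : Fin n) : v j ∈ maximalIdeal S := by
  by_contra hj
  have hsv : s • v = 0 := hA _ (by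
    rw [mulVec_smul]
    exact funext fun i => hann _ (hv i))
  exact hs ((notMem_maximalIdeal.mp hj).mul_left_eq_zero.mp (congrFun hsv j))

/-- Induction on e. A regular element allows passage to a quotient in which dimension and syzygy
order both drop by one; in depth zero a nonzero socle element s gives A (s v) = 0, so v has no unit
entry. -/
lemma mem_maximalIdeal_of_mulVec_mem [IsNoetherianRing S] {e : ℕ} (hdim : ringKrullDim S ≤ e)
    {m n : ℕ} (A : Matrix (Fin m) (Fin n) S) (hA : ∀ v, A *ᵥ v = 0 → v = 0)
    (hsyz : IsSyzygyOfOrder e (LinearMap.range A.mulVecLin))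
    (v : Fin n → S) (hv : ∀ j, (A *ᵥ v) j ∈ maximalIdeal S) (j : Fin n) :
    v j ∈ maximalIdeal S := by
  induction e generalizing S m n with
  | zero =>
    obtain ⟨x, hx, hreg⟩ | ⟨s, hs, hann⟩ :=
      exists_mem_nonZeroDivisors_or_exists_smul_eq_zero (S := S)
    -- A regular element in the maximal ideal would force dimension at least 1.
    · have hle := (ringKrullDim_quotient_succ_le_of_nonZeroDivisor hreg).trans hdim
      have : Nontrivial (S ⧸ Ideal.span {x}) := Ideal.Quotient.nontrivial_iff.mpr
        (((Ideal.span_singleton_le_iff_mem _).mpr hx).trans_lt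
          (maximalIdeal.isMaximal S).ne_top.lt_top).ne
      have h0 : 0 ≤ ringKrullDim (S ⧸ Ideal.span {x}) := ringKrullDim_nonneg_of_nontrivial
      have h1 : (1 : WithBot ℕ∞) ≤ 0 := (le_add_of_nonneg_left h0).trans hle
      exact absurd h1 (by decide)
    · exact mem_maximalIdeal_of_mulVec_mem_of_smul_eq_zero hs hann hA v hv j
  | succ e ih =>
    obtain ⟨x, hx, hreg⟩ | ⟨s, hs, hann⟩ :=
      exists_mem_nonZeroDivisors_or_exists_smul_eq_zero (S := S)
    · have hle := (ringKrullDim_quotient_succ_le_of_nonZeroDivisor hreg).trans hdim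
      have : Nontrivial (S ⧸ Ideal.span {x}) := Ideal.Quotient.nontrivial_iff.mpr
        (((Ideal.span_singleton_le_iff_mem _).mpr hx).trans_lt
          (maximalIdeal.isMaximal S).ne_top.lt_top).ne
      have : IsLocalRing (S ⧸ Ideal.span {x}) :=
        .of_surjective' (Ideal.Quotient.mk _) Ideal.Quotient.mk_surjective
      have : IsLocalHom (Ideal.Quotient.mk (Ideal.span {x})) :=
        .of_surjective _ Ideal.Quotient.mk_surjective
      have hmem (a : S) : Ideal.Quotient.mk (Ideal.span {x}) a ∈ maximalIdeal _ ↔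
          a ∈ maximalIdeal S := by
        rw [← Ideal.mem_comap, maximalIdeal_comap]
      obtain ⟨l, B, hAB, hB⟩ := id hsyz
      rw [← hmem]
      refine ih ?_ (A.map (Ideal.Quotient.mk (Ideal.span {x})))
        (map_mk_mulVec_injective hreg hA hAB) (hsyz.map_mk hreg)
        (Ideal.Quotient.mk _ ∘ v) (fun j => ?_) j
      · push_cast at hle
        exact ENat.WithBot.add_le_add_one_right_iff.mp hle
      · rw [map_comp_mulVec]
        exact (hmem _).mpr (hv j)
    · exact mem_maximalIdeal_of_mulVec_mem_of_smul_eq_zero hs hann hA v hv j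

end LeftInverse

/-! ### Free syzygies and perturbation of presentations -/

section Presentation

variable {S : Type u} [CommRing S]

lemma hasProjectiveDimensionLE_ker {P : Type u} [AddCommGroup P] [Module S P] {m n : ℕ}
    (π : (Fin m → S) →ₗ[S] P) (hπ : Function.Surjective π)
    (h : HasProjectiveDimensionLE (ModuleCat.of S P) (n + 1)) :
    HasProjectiveDimensionLE (ModuleCat.of S (LinearMap.ker π)) n :=
  ((LinearMap.shortExact_shortComplexKer hπ).hasProjectiveDimensionLT_X₃_iff n
    (ModuleCat.projective_of_categoryTheory_projective (ModuleCat.of S (Fin m → S)))).mp h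

variable [IsLocalRing S]

/-- Perturbing the entries of `A` deep in the maximal ideal changes it by an invertible factor. -/
lemma exists_isUnit_mul_eq_of_sub_mem {m n k : ℕ} {A : Matrix (Fin m) (Fin n) S}
    (hk : ∀ a ∈ maximalIdeal S ^ k, ∃ B : Matrix (Fin n) (Fin m) S, B * A = a • 1)
    (A' : Matrix (Fin m) (Fin n) S) (hA' : ∀ i j, A i j - A' i j ∈ maximalIdeal S ^ (k + 1)) :
    ∃ U : Matrix (Fin m) (Fin m) S, IsUnit U.det ∧ U * A = A' := by
  -- The extra factor of the maximal ideal puts the entries of B in it, so that 1 - V below is the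
  -- identity over the residue field.
  have key : ∀ a ∈ maximalIdeal S ^ (k + 1), ∃ B : Matrix (Fin n) (Fin m) S,
      (∀ i j, B i j ∈ maximalIdeal S) ∧ B * A = a • 1 := by
    intro a ha
    rw [pow_succ'] at ha
    refine Submodule.mul_induction_on ha (fun x hx y hy => ?_) fun x y hx hy => ?_
    · obtain ⟨B, hB⟩ := hk y hy
      exact ⟨x • B, fun i j => Ideal.mul_mem_right _ _ hx,
        by rw [Matrix.smul_mul, hB, smul_smul]⟩
    · obtain ⟨B, hB, hBA⟩ := hx
      obtain ⟨C, hC, hCA⟩ := hy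
      exact ⟨B + C, fun i j => add_mem (hB i j) (hC i j),
        by rw [Matrix.add_mul, hBA, hCA, add_smul]⟩
  choose! B hBm hB using key
  let V : Matrix (Fin m) (Fin m) S := Matrix.of fun i l => ∑ j, B (A i j - A' i j) j l
  have hVm (i l) : V i l ∈ maximalIdeal S :=
    sum_mem (t := Finset.univ) (f := fun j => B (A i j - A' i j) j l) fun j _ => hBm _ (hA' i j) j l
  have hV : V * A = A - A' := by
    ext i t
    have h1 (j) : ∑ l, B (A i j - A' i j) j l * A l t = if j = t then A i j - A' i j else 0 := by
      have := congrFun (congrFun (hB _ (hA' i j)) j) t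
      rw [Matrix.mul_apply] at this
      rw [this]
      simp [Matrix.one_apply]
    simp only [Matrix.mul_apply, V, Matrix.of_apply, Finset.sum_mul, Matrix.sub_apply]
    rw [Finset.sum_comm]
    simp [h1]
  refine ⟨1 - V, ?_, by rw [Matrix.sub_mul, hV, Matrix.one_mul, sub_sub_cancel]⟩
  rw [← residue_ne_zero_iff_isUnit, RingHom.map_det]
  have : (residue S).mapMatrix (1 - V) = 1 := by
    rw [map_sub, map_one, sub_eq_self]
    ext i l
    exact (residue_eq_zero_iff _).mpr (hVm i l)
  rw [this, det_one]
  exact one_ne_zero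

variable [IsNoetherianRing S]

lemma exists_matrix_range_eq {m : ℕ} (N : Submodule S (Fin m → S)) [Module.Free S N] :
    ∃ (n : ℕ) (A : Matrix (Fin m) (Fin n) S),
      (∀ v, A *ᵥ v = 0 → v = 0) ∧ LinearMap.range A.mulVecLin = N := by
  let b := Module.finBasis S N
  let f := N.subtype ∘ₗ b.equivFun.symm.toLinearMap
  have hf : (LinearMap.toMatrix' f).mulVecLin = f := by
    rw [← toLin'_apply', toLin'_toMatrix']
  refine ⟨_, LinearMap.toMatrix' f, fun v hv => ?_, ?_⟩
  · rw [← mulVecLin_apply, hf] at hv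
    exact b.equivFun.symm.map_eq_zero_iff.mp (Subtype.ext hv)
  · rw [hf, LinearMap.range_comp_of_range_eq_top _ (LinearEquiv.range _), N.range_subtype]

lemma exists_leftInverse_of_isSyzygyOfOrder {e : ℕ} (hdim : ringKrullDim S ≤ e) {m n : ℕ}
    {A : Matrix (Fin m) (Fin n) S} (hA : ∀ v, A *ᵥ v = 0 → v = 0)
    (hsyz : IsSyzygyOfOrder e (LinearMap.range A.mulVecLin)) :
    ∃ B : Matrix (Fin n) (Fin m) S, B * A = 1 :=
  exists_mul_eq_one_of_forall_mem_maximalIdeal A (mem_maximalIdeal_of_mulVec_mem hdim A hA hsyz)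

/-- The kernel of a free cover of N has smaller projective dimension and syzygy order d + 1. It is
free by induction, and its order matches the bound on dim S, so its inclusion splits. -/
lemma free_of_isSyzygyOfOrder {d n r : ℕ} (hdim : ringKrullDim S ≤ (d + 1 : ℕ))
    (N : Submodule S (Fin r → S)) (hpd : HasProjectiveDimensionLE (ModuleCat.of S N) n)
    (hN : IsSyzygyOfOrder d N) : Module.Free S N := by
  induction n generalizing r with
  | zero =>
    have : Module.Projective S N := by
      rw [← projective_iff_hasProjectiveDimensionLE_zero, ← IsProjective.iff_projective] at hpd
      exact hpd
    exact Module.free_of_flat_of_isLocalRing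
  | succ n ih =>
    obtain ⟨m, π, hπ⟩ := Module.Finite.exists_fin' S N
    let B := LinearMap.toMatrix' (N.subtype ∘ₗ π)
    have hB : B.mulVecLin = N.subtype ∘ₗ π := by rw [← toLin'_apply', toLin'_toMatrix']
    have hrange : LinearMap.range B.mulVecLin = N := by
      rw [hB, LinearMap.range_comp_of_range_eq_top _ (LinearMap.range_eq_top.mpr hπ),
        N.range_subtype]
    have hker : LinearMap.ker π = LinearMap.ker B.mulVecLin := by
      rw [hB, LinearMap.ker_comp_of_ker_eq_bot _ N.ker_subtype]
    have hsyz : IsSyzygyOfOrder (d + 1) (LinearMap.ker π) := ⟨r, B, hker, hrange.symm ▸ hN⟩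
    have : Module.Free S (LinearMap.ker π) :=
      ih _ (hasProjectiveDimensionLE_ker π hπ hpd) hsyz.of_succ
    obtain ⟨k, A, hA, hAker⟩ := exists_matrix_range_eq (LinearMap.ker π)
    obtain ⟨C, hC⟩ := exists_leftInverse_of_isSyzygyOfOrder hdim hA (hAker ▸ hsyz)
    have hexact : Function.Exact A.mulVecLin π := LinearMap.exact_iff.mpr hAker.symm
    have hinj : Function.Injective A.mulVecLin := by
      rw [← LinearMap.ker_eq_bot, LinearMap.ker_eq_bot']
      exact hA
    have hsplit := (hexact.split_tfae hinj hπ).out 0 1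
    obtain ⟨l, hl⟩ := hsplit.mpr ⟨C.mulVecLin, by rw [← mulVecLin_mul, hC, mulVecLin_one]⟩
    have : Module.Projective S N := Module.Projective.of_split l π hl
    exact Module.free_of_flat_of_isLocalRing

/-- The admissible a form an ideal J. Localizing at a nonmaximal prime lowers the dimension to at
most e, so A splits there and J is not contained in that prime; hence J contains a power of the
maximal ideal. -/
lemma exists_pow_maximalIdeal_mul_eq_smul_one {e : ℕ} (hdim : ringKrullDim S ≤ (e + 1 : ℕ))
    {m n : ℕ} {A : Matrix (Fin m) (Fin n) S} (hA : ∀ v, A *ᵥ v = 0 → v = 0)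
    (hsyz : IsSyzygyOfOrder e (LinearMap.range A.mulVecLin)) :
    ∃ k : ℕ, ∀ a ∈ maximalIdeal S ^ k, ∃ B : Matrix (Fin n) (Fin m) S, B * A = a • 1 := by
  let J : Ideal S :=
    { carrier := {a | ∃ B : Matrix (Fin n) (Fin m) S, B * A = a • 1}
      add_mem' := by
        rintro a b ⟨B, hB⟩ ⟨C, hC⟩
        exact ⟨B + C, by rw [Matrix.add_mul, hB, hC, add_smul]⟩
      zero_mem' := ⟨0, by simp⟩
      smul_mem' := by
        rintro c a ⟨B, hB⟩
        exact ⟨c • B, by rw [Matrix.smul_mul, hB, smul_smul, smul_eq_mul]⟩ }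
  have hJ (p : Ideal S) [p.IsPrime] (hp : J ≤ p) : p = maximalIdeal S := by
    by_contra hne
    have hlt : p < maximalIdeal S := lt_of_le_of_ne (le_maximalIdeal Ideal.IsPrime.ne_top') hne
    have hheight : ringKrullDim (Localization.AtPrime p) ≤ e := by
      rw [IsLocalization.AtPrime.ringKrullDim_eq_height p]
      have h1 := Order.add_one_le_of_lt (Ideal.height_strict_mono_of_isPrime hlt)
      rw [← maximalIdeal_height_eq_ringKrullDim] at hdim
      have h2 : (maximalIdeal S).height ≤ (e + 1 : ℕ) := by exact_mod_cast hdim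
      have h3 := h1.trans h2
      push_cast at h3
      have h4 : p.height ≤ e := (ENat.add_le_add_iff_right (by simp)).mp h3
      exact_mod_cast h4
    obtain ⟨B, hB⟩ := exists_leftInverse_of_isSyzygyOfOrder hheight
      (mulVec_map_algebraMap_injective p.primeCompl (Localization.AtPrime p) hA)
      (hsyz.map_algebraMap p.primeCompl (Localization.AtPrime p))
    obtain ⟨s, B', hB'⟩ := exists_mul_eq_smul_one_of_map_algebraMap p.primeCompl
      (Localization.AtPrime p) hB
    exact s.2 (hp ⟨B', hB'⟩)
  have hrad : maximalIdeal S ≤ J.radical := by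
    rw [Ideal.radical_eq_sInf]
    refine le_sInf fun p hp => ?_
    have := hp.2
    exact (hJ p hp.1).ge
  obtain ⟨k, hk⟩ := Ideal.exists_pow_le_of_le_radical_of_fg hrad
    (maximalIdeal S).fg_of_isNoetherianRing
  exact ⟨k, fun a ha => hk ha⟩

end Presentation

/-! ### Descent of the presentation to R -/

section Descent

variable (R : Type u) [CommRing R] [IsLocalRing R] [IsNoetherianRing R]

open TensorProduct in
/-- The completion of the cokernel of a matrix is the cokernel over the completion. -/
lemma exists_surjective_adicCompletion_coker {m n : ℕ} (A : Matrix (Fin m) (Fin n) R) :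
    ∃ π : (Fin m → LocalCompletion R) →ₗ[LocalCompletion R]
        AdicCompletion (maximalIdeal R) ((Fin m → R) ⧸ LinearMap.range A.mulVecLin),
      Function.Surjective π ∧ LinearMap.ker π =
        LinearMap.range (A.map (algebraMap R (LocalCompletion R))).mulVecLin := by
  let C := LocalCompletion R
  let q := (LinearMap.range A.mulVecLin).mkQ
  let em := (TensorProduct.piScalarRight R C C (Fin m)).symm
  let en := (TensorProduct.piScalarRight R C C (Fin n)).symm
  let ψ := AdicCompletion.ofTensorProductEquivOfFiniteNoetherian (maximalIdeal R)
    ((Fin m → R) ⧸ LinearMap.range A.mulVecLin)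
  have hcomm : A.mulVecLin.baseChange C ∘ₗ en.toLinearMap =
      em.toLinearMap ∘ₗ (A.map (algebraMap R C)).mulVecLin := by
    rw [← LinearEquiv.toLinearMap_symm_comp_eq]
    refine LinearMap.pi_ext' fun j => LinearMap.ext_ring ?_
    ext i
    simp [em, en, Algebra.smul_def]
  have hexact : Function.Exact (A.mulVecLin.baseChange C) (q.baseChange C) :=
    lTensor_exact C (LinearMap.exact_map_mkQ_range _) (Submodule.mkQ_surjective _)
  refine ⟨ψ.toLinearMap ∘ₗ q.baseChange C ∘ₗ em.toLinearMap, ?_, ?_⟩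
  · exact ψ.surjective.comp ((LinearMap.lTensor_surjective C (Submodule.mkQ_surjective _)).comp
      em.surjective)
  · ext v
    have : v ∈ LinearMap.range (A.map (algebraMap R C)).mulVecLin ↔
        em v ∈ LinearMap.range (A.mulVecLin.baseChange C) := by
      rw [← LinearMap.range_comp_of_range_eq_top (f := en.toLinearMap) _ (LinearEquiv.range _),
        hcomm]
      constructor
      · rintro ⟨w, rfl⟩
        exact ⟨w, rfl⟩
      · rintro ⟨w, hw⟩
        exact ⟨w, em.injective hw⟩
    rw [this, ← LinearMap.exact_iff.mp hexact]
    simp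

lemma isAlgebraicModule_of_isSyzygyOfOrder {e m : ℕ} (hdim : ringKrullDim R ≤ (e + 1 : ℕ))
    {P : Type u} [AddCommGroup P] [Module (LocalCompletion R) P]
    (hpd : HasFiniteProjectiveDimension (LocalCompletion R) P)
    (π : (Fin m → LocalCompletion R) →ₗ[LocalCompletion R] P) (hπ : Function.Surjective π)
    (hsyz : IsSyzygyOfOrder e (LinearMap.ker π)) : IsAlgebraicModule R P := by
  have hdim' := (ringKrullDim_localCompletion_le R).trans hdim
  obtain ⟨d, hd⟩ := hpd
  -- The bound is raised by one because passing to the kernel lowers it by one, and d may be 0.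
  have hd' : HasProjectiveDimensionLE (ModuleCat.of (LocalCompletion R) P) (d + 1) :=
    hasProjectiveDimensionLT_of_ge _ (d + 1) _ (by lia)
  have := free_of_isSyzygyOfOrder hdim' _ (hasProjectiveDimensionLE_ker π hπ hd') hsyz
  obtain ⟨n, A, hA, hAker⟩ := exists_matrix_range_eq (LinearMap.ker π)
  obtain ⟨k, hk⟩ := exists_pow_maximalIdeal_mul_eq_smul_one hdim' hA (hAker ▸ hsyz)
  choose r hr using fun i j => exists_sub_algebraMap_mem_maximalIdeal_pow R (A i j) (k + 1)
  let A₀ : Matrix (Fin m) (Fin n) R := Matrix.of r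
  obtain ⟨U, hU, hUA⟩ := exists_isUnit_mul_eq_of_sub_mem hk
    (A₀.map (algebraMap R (LocalCompletion R))) hr
  obtain ⟨ρ, hρ, hρker⟩ := exists_surjective_adicCompletion_coker R A₀
  let u : (Fin m → LocalCompletion R) ≃ₗ[LocalCompletion R] (Fin m → LocalCompletion R) :=
    Matrix.toLin'OfInv (nonsing_inv_mul U hU) (mul_nonsing_inv U hU)
  have hmap : (LinearMap.ker π).map u.toLinearMap = LinearMap.ker ρ := by
    have hu : u.toLinearMap = U.mulVecLin := LinearMap.ext fun v => Matrix.toLin'_apply U v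
    rw [hρker, ← hAker, ← LinearMap.range_comp, ← hUA, mulVecLin_mul, hu]
  exact ⟨(Fin m → R) ⧸ LinearMap.range A₀.mulVecLin, inferInstance, inferInstance, inferInstance,
    ⟨(π.quotKerEquivOfSurjective hπ).symm ≪≫ₗ Submodule.Quotient.equiv _ _ u hmap ≪≫ₗ
      ρ.quotKerEquivOfSurjective hρ⟩⟩

end Descent

/-! ### Syzygies from duality -/

section Dual

variable {S : Type u} [CommRing S] {M : Type v} [AddCommGroup M] [Module S M]

lemma IsTorsionlessModule.submodule (h : IsTorsionlessModule S M) (P : Submodule S M) :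
    IsTorsionlessModule S P := by
  refine .of_comp (f := P.subtype.dualMap.dualMap) ?_
  exact h.comp P.injective_subtype

variable [IsNoetherianRing S] [Module.Finite S M]

lemma IsTorsionlessModule.exists_injective (h : IsTorsionlessModule S M) :
    ∃ (l : ℕ) (ι : M →ₗ[S] (Fin l → S)), Function.Injective ι := by
  obtain ⟨l, g, hg⟩ := Module.Finite.exists_fin' S (Module.Dual S M)
  refine ⟨l, LinearMap.pi fun i => g (Pi.single i 1), ?_⟩
  rw [← LinearMap.ker_eq_bot, LinearMap.ker_eq_bot']
  intro x hx
  apply h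
  rw [map_zero]
  ext φ
  obtain ⟨c, rfl⟩ := hg φ
  have : Module.Dual.eval S M x ∘ₗ g = 0 :=
    LinearMap.pi_ext' fun i => LinearMap.ext_ring (congrFun hx i)
  exact LinearMap.congr_fun this c

/-- Dualizing a finite presentation of the dual gives a left exact sequence starting at the double
dual, which is M. -/
lemma exists_exact_of_isReflexive [Module.IsReflexive S M] :
    ∃ (l k : ℕ) (ι : M →ₗ[S] (Fin l → S)) (B : Matrix (Fin k) (Fin l) S), Function.Injective ι ∧
      LinearMap.range ι = LinearMap.ker B.mulVecLin := by
  obtain ⟨l, g, hg⟩ := Module.Finite.exists_fin' S (Module.Dual S M)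
  obtain ⟨k, f, hf⟩ := Module.Finite.exists_fin' S (LinearMap.ker g)
  let F := LinearMap.toMatrix' ((LinearMap.ker g).subtype ∘ₗ f)
  have hF (w) : F *ᵥ w = (f w : Fin l → S) := by
    rw [← toLin'_apply, toLin'_toMatrix']
    rfl
  have hι (x : M) (c : Fin l → S) : c ⬝ᵥ (fun i => g (Pi.single i 1) x) = g c x := by
    conv_rhs => rw [pi_eq_sum_univ' c]
    simp [dotProduct, LinearMap.sum_apply]
  refine ⟨l, k, LinearMap.pi fun i => g (Pi.single i 1), Fᵀ, ?_, ?_⟩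
  · rw [← LinearMap.ker_eq_bot, LinearMap.ker_eq_bot']
    intro x hx
    apply (Module.bijective_dual_eval S M).1
    rw [map_zero]
    ext φ
    obtain ⟨c, rfl⟩ := hg φ
    have h := hι x c
    have h0 : (fun i => g (Pi.single i 1) x) = 0 := hx
    rw [h0, dotProduct_zero] at h
    exact h.symm
  · have hFt (w y) : w ⬝ᵥ (Fᵀ *ᵥ y) = (f w : Fin l → S) ⬝ᵥ y := by
      rw [dotProduct_mulVec, vecMul_transpose, hF]
    apply le_antisymm
    · rintro _ ⟨x, rfl⟩
      rw [LinearMap.mem_ker, mulVecLin_apply]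
      refine dotProduct_eq_zero _ fun w => ?_
      rw [dotProduct_comm, hFt]
      refine (hι x _).trans ?_
      rw [LinearMap.mem_ker.mp (f w).2, LinearMap.zero_apply]
    · intro y hy
      rw [LinearMap.mem_ker, mulVecLin_apply] at hy
      let δ : (Fin l → S) →ₗ[S] S := (dotProductBilin S S).flip y
      -- Pairing with y kills the relations of the dual, so it descends to a functional there, which
      -- reflexivity realizes as evaluation at some x.
      have hδ : LinearMap.ker g ≤ LinearMap.ker δ := by
        intro c hc
        obtain ⟨w, hw⟩ := hf ⟨c, hc⟩
        have h := hFt w y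
        rw [hy, dotProduct_zero, hw] at h
        exact h.symm
      obtain ⟨x, hx⟩ := (Module.bijective_dual_eval S M).2
        ((LinearMap.ker g).liftQ δ hδ ∘ₗ (g.quotKerEquivOfSurjective hg).symm.toLinearMap)
      refine ⟨x, dotProduct_eq _ _ fun c => ?_⟩
      rw [dotProduct_comm, dotProduct_comm y]
      refine (hι x c).trans ?_
      have h := LinearMap.congr_fun hx (g c)
      have hc : (g.quotKerEquivOfSurjective hg).symm (g c) = Submodule.Quotient.mk c := by
        rw [LinearEquiv.symm_apply_eq]
        rfl
      simp only [Module.Dual.eval_apply, LinearMap.comp_apply, LinearEquiv.coe_coe, hc] at h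
      exact h

end Dual

/-! ### Direct summands and the three cases -/

section Main

variable {S : Type u} [CommRing S]

lemma HasFiniteProjectiveDimension.of_isCompl {M : Type u} [AddCommGroup M] [Module S M]
    (h : HasFiniteProjectiveDimension S M) {P Q : Submodule S M} (hPQ : IsCompl P Q) :
    HasFiniteProjectiveDimension S P := by
  obtain ⟨n, hn⟩ := h
  let ret : Retract (ModuleCat.of S P) (ModuleCat.of S M) :=
    { i := ModuleCat.ofHom P.subtype
      r := ModuleCat.ofHom (P.projectionOnto Q hPQ)
      retract := by
        ext x
        simp }
  exact ⟨n, ret.hasProjectiveDimensionLT (n + 1)⟩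

lemma ker_comp_eq_ker {X Y Z : Type*} [AddCommGroup X] [Module S X] [AddCommGroup Y] [Module S Y]
    [AddCommGroup Z] [Module S Z] (π : X →ₗ[S] Y) {ι : Y →ₗ[S] Z} (hι : Function.Injective ι) :
    LinearMap.ker π = LinearMap.ker (ι ∘ₗ π) :=
  (LinearMap.ker_comp_of_ker_eq_bot π (LinearMap.ker_eq_bot.mpr hι)).symm

theorem corollary3p10 (R : Type u) [CommRing R] [IsLocalRing R] [IsNoetherianRing R]
    (M : Type u) [AddCommGroup M] [Module (LocalCompletion R) M]
    [Module.Finite (LocalCompletion R) M]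
    (hpd : HasFiniteProjectiveDimension (LocalCompletion R) M)
    (h : ringKrullDim R = 1 ∨
      (ringKrullDim R = 2 ∧ IsTorsionlessModule (LocalCompletion R) M) ∨
      (ringKrullDim R = 3 ∧ Module.IsReflexive (LocalCompletion R) M)) :
    IsStronglyAlgebraicModule R M := by
  intro P Q hPQ
  have hP := hpd.of_isCompl hPQ
  obtain ⟨m, π, hπ⟩ := Module.Finite.exists_fin' (LocalCompletion R) P
  obtain hd | ⟨hd, htl⟩ | ⟨hd, hrefl⟩ := h
  · exact isAlgebraicModule_of_isSyzygyOfOrder (e := 0) R (by simp [hd]) hP π hπ trivial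
  · obtain ⟨l, ι, hι⟩ := (htl.submodule P).exists_injective
    refine isAlgebraicModule_of_isSyzygyOfOrder (e := 1) R (by simp [hd]) hP π hπ ?_
    refine ⟨l, LinearMap.toMatrix' (ι ∘ₗ π), ?_, trivial⟩
    rw [ker_comp_eq_ker π hι, ← toLin'_apply', toLin'_toMatrix']
  · have : Module.IsReflexive (LocalCompletion R) P :=
      .of_split P.subtype (P.projectionOnto Q hPQ) (LinearMap.ext fun x => by simp)
    obtain ⟨l, k, ι, B, hι, hB⟩ := exists_exact_of_isReflexive (S := LocalCompletion R) (M := P)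
    refine isAlgebraicModule_of_isSyzygyOfOrder (e := 2) R (by simp [hd]) hP π hπ ?_
    have hmat : (LinearMap.toMatrix' (ι ∘ₗ π)).mulVecLin = ι ∘ₗ π := by
      rw [← toLin'_apply', toLin'_toMatrix']
    refine ⟨l, LinearMap.toMatrix' (ι ∘ₗ π), ?_, k, B, ?_, trivial⟩
    · rw [hmat, ker_comp_eq_ker π hι]
    · rw [hmat, LinearMap.range_comp_of_range_eq_top _ (LinearMap.range_eq_top.mpr hπ), hB]

end Main
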